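/- Consider the following online set cover problem. A finite set $\mathcal{S}$ of closed axis-parallel squares in $\mathbb{R}^2$, of arbitrary positive side lengths, is given up front. Points arrive one by one. When a point arrives, a deterministic online algorithm, knowing only the data given up front and the points that have arrived so far, adds squares of $\mathcal{S}$ (possibly none or several) to its solution; squares are never removed. For $r \ge 0$, the algorithm is called $r$-competitive if, for every finite sequence of arriving points (from the points that are allowed to arrive) each of which lies in some square of $\mathcal{S}$, after every round its solution covers all points that have arrived so far and has at most $r\cdot\mathrm{OPT}$ squares, where $\mathrm{OPT}$ is the minimum number of squares of $\mathcal{S}$ that cover all points that have arrived so far. (1) There are an absolute constant $C$ and a deterministic online algorithm with the following property. Suppose that, in addition to $\mathcal{S}$, a set $P_0\subseteq\mathbb{R}^2$ of $n$ candidate points is given up front and that only points of $P_0$ may arrive. Then the algorithm is $C\log(n+1)$-competitive; that is, it is $O(\log n)$-competitive. (2) There are an absolute constant $C$ and a deterministic online algorithm with the following property. Suppose that, in addition to $\mathcal{S}$, a non-negative integer $N$ is given up front, that all corners of the squares in $\mathcal{S}$ have integral coordinates in $[0,N)^2$, and that only points with integral coordinates in $[0,N)^2$ may arrive. Then the algorithm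 is $C\log(N+1)$-competitive; that is, it is $O(\log N)$-competitive. -/

import Mathlib

/-- A point of the plane `ℝ²`. -/
abbrev Point : Type := ℝ × ℝ

/-- An axis-parallel square of positive side length, given by its bottom-left corner `(x, y)` and
its side length. Distinct values of this type are distinct subsets of the plane. -/
structure Square where
  x : ℝ
  y : ℝ
  side : ℝ
  side_pos : 0 < side

/-- The closed region `[x, x + side] × [y, y + side]` covered by a square. -/
def Square.region (s : Square) : Set Point :=
  Set.Icc s.x (s.x + s.side) ×ˢ Set.Icc s.y (s.y + s.side)

/-- `Covers T P`: every point of `P` lies in some square of `T`, that is, `T` is a set cover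
of `P`. -/
def Covers (T : Finset Square) (P : Set Point) : Prop :=
  ∀ p ∈ P, ∃ s ∈ T, p ∈ s.region

/-- The size of a smallest set cover of `P` with squares from `S` (meaningful if `S` covers `P`). -/
noncomputable def optCover (S : Finset Square) (P : Set Point) : ℕ :=
  sInf {k : ℕ | ∃ T : Finset Square, T ⊆ S ∧ Covers T P ∧ T.card = k}

/-- A deterministic online algorithm for set cover with the squares in `S`. When the point `p`
arrives after the points of the list `past` (in their order of arrival), the algorithm adds the
squares in `select past p`, a subset of `S`, to its solution. Nothing is ever removed. -/
structure OnlineAlgorithm (S : Finset Square) where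
  select : List Point → Point → Finset Square
  select_subset : ∀ past p, select past p ⊆ S

open Classical in
/-- The solution that the algorithm holds after the points of the list `l` have arrived one by one
in this order: the union over all rounds of the squares added in that round. -/
noncomputable def OnlineAlgorithm.solution {S : Finset Square} (A : OnlineAlgorithm S)
    (l : List Point) : Finset Square :=
  Finset.univ.biUnion fun i : Fin l.length => A.select (l.take i) (l.get i)

/-- `A` is `r`-competitive when the adversary may introduce points of `U` only: on each finite
request sequence from `U` that can be covered with squares from `S` at all, the solution of `A`
covers all points that have arrived and has at most `r` times the optimal size. Since every prefix
of a request sequence is again a request sequence, both hold after every single round. -/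
def OnlineAlgorithm.IsCompetitive {S : Finset Square} (A : OnlineAlgorithm S) (U : Set Point)
    (r : ℝ) : Prop :=
  ∀ l : List Point, (∀ p ∈ l, p ∈ U) → Covers S {p | p ∈ l} →
    Covers (A.solution l) {p | p ∈ l} ∧
      ((A.solution l).card : ℝ) ≤ r * (optCover S {p | p ∈ l} : ℝ)

/-- The points with integral coordinates in `[0, N)²`. -/
def gridPoints (N : ℕ) : Set Point :=
  {p | ∃ a b : ℕ, a < N ∧ b < N ∧ p = ((a : ℝ), (b : ℝ))}

/-- All four corners of the square have integral coordinates in `[0, N)²`. -/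
def Square.OnGrid (N : ℕ) (s : Square) : Prop :=
  (s.x, s.y) ∈ gridPoints N ∧ (s.x + s.side, s.y) ∈ gridPoints N ∧
    (s.x, s.y + s.side) ∈ gridPoints N ∧ (s.x + s.side, s.y + s.side) ∈ gridPoints N

/-! Before any point arrives, a fixed square `f p` of `S` is assigned to each candidate point that
can be covered; the algorithm buys `f p` whenever `p` arrives uncovered. The assignment comes from a
balanced quadtree whose regions are cells and differences of two nested cells.

If a square covers a point of a region without having a corner there, only one of its edges matters
near that point. Such squares fall into at most twelve chains with nested traces, so the largest
square of `S` in a chain does the work of all the others. A point that some chain at its region can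
serve is assigned the largest square of such a chain; the remaining points are passed to subregions.
Each region thus causes at most twelve purchases of its own.

If points are passed down, every square that covers them in a given cover has a corner in the
region. The purchases below are therefore charged to corners, which split additively among disjoint
subregions (`HasSelectionRule.of_partition`). Regions split into at most five parts, and two levels
of splitting halve the number of candidates (`hasSelectionRule_of_pointCount_le`). Four corners per
square and logarithmic depth give the ratio. Integral points in `[0, N)²` number at most `N ^ 2`, so
the second part reduces to the first. -/

/-! ### Chains of squares -/

/-- A family of squares whose traces on a region form a chain: on the region, membership in a
square of the family is decided by comparing two real numbers. -/
structure SquareChain where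
  family : Set Square
  region : Set Point
  extent : Square → ℝ
  height : Point → ℝ
  mem_iff : ∀ s ∈ family, ∀ p ∈ region, p ∈ s.region ↔ height p ≤ extent s

theorem Square.mem_region {s : Square} {p : Point} :
    p ∈ s.region ↔ (s.x ≤ p.1 ∧ p.1 ≤ s.x + s.side) ∧ s.y ≤ p.2 ∧ p.2 ≤ s.y + s.side :=
  Iff.rfl

namespace SquareChain

/-- The squares of which only the top edge can cut off points of `R`. -/
def up (R : Set Point) : SquareChain where
  family := {s | ∀ p ∈ R, (s.x ≤ p.1 ∧ p.1 ≤ s.x + s.side) ∧ s.y ≤ p.2}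
  region := R
  extent s := s.y + s.side
  height p := p.2
  mem_iff s hs p hp := by
    have := hs p hp
    rw [Square.mem_region]
    tauto

/-- The squares of which only the bottom edge can cut off points of `R`. -/
def down (R : Set Point) : SquareChain where
  family := {s | ∀ p ∈ R, (s.x ≤ p.1 ∧ p.1 ≤ s.x + s.side) ∧ p.2 ≤ s.y + s.side}
  region := R
  extent s := -s.y
  height p := -p.2
  mem_iff s hs p hp := by
    have := hs p hp
    rw [Square.mem_region, neg_le_neg_iff]
    tauto

/-- The squares of which only the right edge can cut off points of `R`. -/
def right (R : Set Point) : SquareChain where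
  family := {s | ∀ p ∈ R, (s.y ≤ p.2 ∧ p.2 ≤ s.y + s.side) ∧ s.x ≤ p.1}
  region := R
  extent s := s.x + s.side
  height p := p.1
  mem_iff s hs p hp := by
    have := hs p hp
    rw [Square.mem_region]
    tauto

/-- The squares of which only the left edge can cut off points of `R`. -/
def left (R : Set Point) : SquareChain where
  family := {s | ∀ p ∈ R, (s.y ≤ p.2 ∧ p.2 ≤ s.y + s.side) ∧ p.1 ≤ s.x + s.side}
  region := R
  extent s := -s.x
  height p := -p.1
  mem_iff s hs p hp := by
    have := hs p hp
    rw [Square.mem_region, neg_le_neg_iff]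
    tauto

end SquareChain

/-- The four corners of a square. -/
def Square.corner (s : Square) (i : Bool × Bool) : Point :=
  (if i.1 then s.x + s.side else s.x, if i.2 then s.y + s.side else s.y)

/-- Twelve chains suffice for the squares that meet `c` and have no corner in `c`. -/
def ChainCovered (c : Set Point) : Prop :=
  ∃ L : List SquareChain, L.length ≤ 12 ∧ ∀ s : Square, ∀ p ∈ c, p ∈ s.region →
    (∀ i, s.corner i ∉ c) → ∃ C ∈ L, s ∈ C.family ∧ p ∈ C.region

/-! ### Quadtree cells -/

/-- The half-open square `[x, x + side) × [y, y + side)`, used as a quadtree cell. -/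
def Square.cell (s : Square) : Set Point :=
  Set.Ico s.x (s.x + s.side) ×ˢ Set.Ico s.y (s.y + s.side)

theorem Square.mem_cell {s : Square} {p : Point} :
    p ∈ s.cell ↔ (s.x ≤ p.1 ∧ p.1 < s.x + s.side) ∧ s.y ≤ p.2 ∧ p.2 < s.y + s.side :=
  Iff.rfl

/-- The four children of a quadtree cell. -/
noncomputable def Square.child (s : Square) (i : Bool × Bool) : Square where
  x := if i.1 then s.x + s.side / 2 else s.x
  y := if i.2 then s.y + s.side / 2 else s.y
  side := s.side / 2
  side_pos := half_pos s.side_pos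

/-- `H` is a quadtree cell obtained from `Q` by repeated subdivision. -/
def Square.Descendant (Q H : Square) : Prop :=
  Relation.ReflTransGen (fun s t : Square => ∃ i, t = s.child i) Q H

/-- `H` is contained in `Q`, and on each of the four sides its distance to the boundary of `Q` is
either zero or at least its own side length. -/
structure Square.Sticky (Q H : Square) : Prop where
  side_le : H.side ≤ Q.side
  left : H.x = Q.x ∨ Q.x + H.side ≤ H.x
  right : H.x + H.side = Q.x + Q.side ∨ H.x + 2 * H.side ≤ Q.x + Q.side
  bottom : H.y = Q.y ∨ Q.y + H.side ≤ H.y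
  top : H.y + H.side = Q.y + Q.side ∨ H.y + 2 * H.side ≤ Q.y + Q.side

/-- Each side of a child lies on the parent's boundary or is one child side length away from it, and
that length is at least `H.side`. -/
theorem Square.Descendant.sticky {Q H : Square} (h : Q.Descendant H) : Q.Sticky H := by
  induction h using Relation.ReflTransGen.head_induction_on with
  | refl => exact ⟨le_rfl, Or.inl rfl, Or.inl rfl, Or.inl rfl, Or.inl rfl⟩
  | @head a b hab _ ih =>
    obtain ⟨⟨i, j⟩, rfl⟩ := hab
    obtain ⟨h0, h1, h2, h3, h4⟩ := ih
    have ha := a.side_pos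
    have hH := H.side_pos
    cases i <;> cases j <;>
      simp only [Square.child, if_true, if_false, Bool.false_eq_true] at h0 h1 h2 h3 h4 <;>
      refine ⟨by linarith, ?_, ?_, ?_, ?_⟩ <;>
      first
        | assumption
        | (right; rcases h1 with h1 | h1 <;> linarith)
        | (right; rcases h2 with h2 | h2 <;> linarith)
        | (right; rcases h3 with h3 | h3 <;> linarith)
        | (right; rcases h4 with h4 | h4 <;> linarith)
        | (rcases h2 with h2 | h2
           · left; linarith
           · right; linarith)
        | (rcases h4 with h4 | h4
           · left; linarith
           · right; linarith)

theorem Square.Descendant.cell_subset {Q H : Square} (h : Q.Descendant H) : H.cell ⊆ Q.cell := by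
  obtain ⟨h0, h1, h2, h3, h4⟩ := h.sticky
  have hH := H.side_pos
  intro p hp
  rw [Square.mem_cell] at hp ⊢
  obtain ⟨⟨a, b⟩, d, e⟩ := hp
  refine ⟨⟨?_, ?_⟩, ?_, ?_⟩
  · rcases h1 with h1 | h1 <;> linarith
  · rcases h2 with h2 | h2 <;> linarith
  · rcases h3 with h3 | h3 <;> linarith
  · rcases h4 with h4 | h4 <;> linarith

theorem Square.mem_cell_iff_exists_child {s : Square} {p : Point} :
    p ∈ s.cell ↔ ∃ i, p ∈ (s.child i).cell := by
  have hs := s.side_pos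
  constructor
  · intro h
    rw [Square.mem_cell] at h
    refine ⟨(decide (s.x + s.side / 2 ≤ p.1), decide (s.y + s.side / 2 ≤ p.2)), ?_⟩
    rw [Square.mem_cell]
    simp only [Square.child, decide_eq_true_eq]
    split_ifs <;> refine ⟨⟨?_, ?_⟩, ?_, ?_⟩ <;> linarith [h.1.1, h.1.2, h.2.1, h.2.2]
  · rintro ⟨i, hi⟩
    exact Square.Descendant.cell_subset (Relation.ReflTransGen.single ⟨i, rfl⟩) hi

theorem Square.child_cell_disjoint (s : Square) {i j : Bool × Bool} (hij : i ≠ j) :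
    Disjoint (s.child i).cell (s.child j).cell := by
  rw [Set.disjoint_left]
  intro p hi hj
  rw [Square.mem_cell] at hi hj
  apply hij
  obtain ⟨i1, i2⟩ := i
  obtain ⟨j1, j2⟩ := j
  obtain ⟨⟨a1, a2⟩, a3, a4⟩ := hi
  obtain ⟨⟨b1, b2⟩, b3, b4⟩ := hj
  have h1 : i1 = j1 := by
    cases i1 <;> cases j1 <;> simp [Square.child] at * <;> linarith
  have h2 : i2 = j2 := by
    cases i2 <;> cases j2 <;> simp [Square.child] at * <;> linarith
  rw [h1, h2]

/-- If two adjacent edges cut the cell, their common corner lies in it. Two opposite edges cannot do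
so alone: the square would span the cell in one direction and be shorter than it in the other. So at
most one edge cuts. -/
theorem Square.chainCovered_cell (Q : Square) : ChainCovered Q.cell := by
  refine ⟨[.up Q.cell, .down Q.cell, .left Q.cell, .right Q.cell], by simp, ?_⟩
  intro s p hp hs hc
  have hp' := hp
  rw [Square.mem_cell] at hp
  rw [Square.mem_region] at hs
  obtain ⟨⟨p1, p2⟩, p3, p4⟩ := hp
  obtain ⟨⟨s1, s2⟩, s3, s4⟩ := hs
  have c00 := hc (false, false)
  have c01 := hc (false, true)
  have c10 := hc (true, false)
  have c11 := hc (true, true)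
  have hs := s.side_pos
  simp only [Square.mem_cell, Square.corner, if_true, if_false, Bool.false_eq_true, not_and,
    not_lt, and_imp] at c00 c01 c10 c11
  simp only [List.mem_cons, List.not_mem_nil, or_false, exists_eq_or_imp, exists_eq_left,
    SquareChain.up, SquareChain.down, SquareChain.left, SquareChain.right, Set.mem_ofPred_eq,
    hp', and_true, Square.mem_cell]
  rcases lt_or_ge s.x Q.x with h1 | h1 <;>
  rcases lt_or_ge (s.x + s.side) (Q.x + Q.side) with h2 | h2 <;>
  rcases lt_or_ge s.y Q.y with h3 | h3 <;>
  rcases lt_or_ge (s.y + s.side) (Q.y + Q.side) with h4 | h4 <;>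
  first
    | (exfalso; linarith)
    | (exfalso; linarith [c00 (by linarith) (by linarith) (by linarith)])
    | (exfalso; linarith [c01 (by linarith) (by linarith) (by linarith)])
    | (exfalso; linarith [c10 (by linarith) (by linarith) (by linarith)])
    | (exfalso; linarith [c11 (by linarith) (by linarith) (by linarith)])
    | (left; rintro q ⟨⟨q1, q2⟩, q3, q4⟩; refine ⟨⟨?_, ?_⟩, ?_⟩ <;> linarith)
    | (right; left; rintro q ⟨⟨q1, q2⟩, q3, q4⟩; refine ⟨⟨?_, ?_⟩, ?_⟩ <;> linarith)
    | (right; right; left; rintro q ⟨⟨q1, q2⟩, q3, q4⟩; refine ⟨⟨?_, ?_⟩, ?_⟩ <;> linarith)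
    | (right; right; right; rintro q ⟨⟨q1, q2⟩, q3, q4⟩; refine ⟨⟨?_, ?_⟩, ?_⟩ <;> linarith)

/-- A square that meets `Q \ H` and has no corner there either contains an edge of `Q` or has
exactly one corner in `Q`; this corner lies in `H`, and beside, above or below `H` only one edge of
the square can cut off points. -/
theorem Square.Sticky.chainCovered {Q H : Square} (h : Q.Sticky H) :
    ChainCovered (Q.cell \ H.cell) := by
  set c := Q.cell \ H.cell with hcdef
  refine ⟨[.up c, .down c, .left c, .right c,
    .up {p ∈ c | p.1 < H.x}, .up {p ∈ c | H.x + H.side ≤ p.1},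
    .down {p ∈ c | p.1 < H.x}, .down {p ∈ c | H.x + H.side ≤ p.1},
    .left {p ∈ c | p.2 < H.y}, .left {p ∈ c | H.y + H.side ≤ p.2},
    .right {p ∈ c | p.2 < H.y}, .right {p ∈ c | H.y + H.side ≤ p.2}], by simp, ?_⟩
  intro s p hp hs hc
  obtain ⟨h0, hl, hr, hb, ht⟩ := h
  have hpc := hp
  have hpQ := hp.1
  have hpH := hp.2
  rw [Square.mem_cell] at hpQ
  rw [Square.mem_region] at hs
  obtain ⟨⟨p1, p2⟩, p3, p4⟩ := hpQ
  obtain ⟨⟨s1, s2⟩, s3, s4⟩ := hs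
  have key : ∀ i, s.corner i ∈ Q.cell → s.corner i ∈ H.cell := fun i hi => by
    by_contra hn
    exact hc i ⟨hi, hn⟩
  have c00 := key (false, false)
  have c01 := key (false, true)
  have c10 := key (true, false)
  have c11 := key (true, true)
  have hs := s.side_pos
  have hout : p.1 < H.x ∨ H.x + H.side ≤ p.1 ∨ p.2 < H.y ∨ H.y + H.side ≤ p.2 := by
    by_contra! hcon
    exact hpH (Square.mem_cell.2 ⟨⟨hcon.1, hcon.2.1⟩, hcon.2.2.1, hcon.2.2.2⟩)
  have hmem : ∀ q ∈ c, (Q.x ≤ q.1 ∧ q.1 < Q.x + Q.side) ∧ Q.y ≤ q.2 ∧ q.2 < Q.y + Q.side :=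
    fun q hq => Square.mem_cell.1 hq.1
  simp only [Square.mem_cell, Square.corner, if_true, if_false, Bool.false_eq_true,
    and_imp] at c00 c01 c10 c11
  clear_value c
  clear hc key hpH hcdef
  simp only [List.mem_cons, List.not_mem_nil, or_false, exists_eq_or_imp, exists_eq_left,
    SquareChain.up, SquareChain.down, SquareChain.left, SquareChain.right, Set.mem_ofPred_eq,
    hpc, true_and, and_true]
  rcases lt_or_ge s.x Q.x with h1 | h1 <;>
  rcases lt_or_ge (s.x + s.side) (Q.x + Q.side) with h2 | h2 <;>
  rcases lt_or_ge s.y Q.y with h3 | h3 <;>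
  rcases lt_or_ge (s.y + s.side) (Q.y + Q.side) with h4 | h4
  all_goals first
    | (exfalso; linarith)
    | (left; intro q hq; obtain ⟨⟨q1, q2⟩, q3, q4⟩ := hmem q hq
       refine ⟨⟨?_, ?_⟩, ?_⟩ <;> linarith)
    | (right; left; intro q hq; obtain ⟨⟨q1, q2⟩, q3, q4⟩ := hmem q hq
       refine ⟨⟨?_, ?_⟩, ?_⟩ <;> linarith)
    | (right; right; left; intro q hq; obtain ⟨⟨q1, q2⟩, q3, q4⟩ := hmem q hq
       refine ⟨⟨?_, ?_⟩, ?_⟩ <;> linarith)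
    | (right; right; right; left; intro q hq; obtain ⟨⟨q1, q2⟩, q3, q4⟩ := hmem q hq
       refine ⟨⟨?_, ?_⟩, ?_⟩ <;> linarith)
    | skip
  -- Nine cases remain, with one, two or four corners in `Q`, hence in `H`. Four put the square
  -- inside `H`. Two force its side below `H.side`; where it leaves `Q`, either `H` touches the
  -- boundary and contains its trace, or `H` is too far from the boundary for it to reach.
  · obtain ⟨⟨e1, e2⟩, e3, e4⟩ := c11 (by linarith) (by linarith) (by linarith) (by linarith)
    rcases hout with hout | hout | hout | hout
    · refine Or.inr (Or.inr (Or.inr (Or.inr (Or.inl ⟨fun q hq => ?_, hout⟩))))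
      obtain ⟨⟨q1, q2⟩, q3, q4⟩ := hmem q hq.1
      have := hq.2
      refine ⟨⟨?_, ?_⟩, ?_⟩ <;> linarith
    · exfalso; linarith
    · refine Or.inr (Or.inr (Or.inr (Or.inr (Or.inr (Or.inr (Or.inr (Or.inr (Or.inr (Or.inr (Or.inl ⟨fun q hq => ?_, hout⟩))))))))))
      obtain ⟨⟨q1, q2⟩, q3, q4⟩ := hmem q hq.1
      have := hq.2
      refine ⟨⟨?_, ?_⟩, ?_⟩ <;> linarith
    · exfalso; linarith
  · obtain ⟨⟨e1, e2⟩, e3, e4⟩ := c10 (by linarith) (by linarith) (by linarith) (by linarith)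
    obtain ⟨⟨g1, g2⟩, g3, g4⟩ := c11 (by linarith) (by linarith) (by linarith) (by linarith)
    exfalso
    rcases hl with hl | hl <;> rcases hout with hout | hout | hout | hout <;> linarith
  · obtain ⟨⟨e1, e2⟩, e3, e4⟩ := c10 (by linarith) (by linarith) (by linarith) (by linarith)
    rcases hout with hout | hout | hout | hout
    · refine Or.inr (Or.inr (Or.inr (Or.inr (Or.inr (Or.inr (Or.inl ⟨fun q hq => ?_, hout⟩))))))
      obtain ⟨⟨q1, q2⟩, q3, q4⟩ := hmem q hq.1
      have := hq.2
      refine ⟨⟨?_, ?_⟩, ?_⟩ <;> linarith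
    · exfalso; linarith
    · exfalso; linarith
    · refine Or.inr (Or.inr (Or.inr (Or.inr (Or.inr (Or.inr (Or.inr (Or.inr (Or.inr (Or.inr (Or.inr (⟨fun q hq => ?_, hout⟩)))))))))))
      obtain ⟨⟨q1, q2⟩, q3, q4⟩ := hmem q hq.1
      have := hq.2
      refine ⟨⟨?_, ?_⟩, ?_⟩ <;> linarith
  · obtain ⟨⟨e1, e2⟩, e3, e4⟩ := c01 (by linarith) (by linarith) (by linarith) (by linarith)
    obtain ⟨⟨g1, g2⟩, g3, g4⟩ := c11 (by linarith) (by linarith) (by linarith) (by linarith)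
    exfalso
    rcases hb with hb | hb <;> rcases hout with hout | hout | hout | hout <;> linarith
  · obtain ⟨⟨e1, e2⟩, e3, e4⟩ := c00 (by linarith) (by linarith) (by linarith) (by linarith)
    obtain ⟨⟨g1, g2⟩, g3, g4⟩ := c11 (by linarith) (by linarith) (by linarith) (by linarith)
    exfalso
    rcases hout with hout | hout | hout | hout <;> linarith
  · obtain ⟨⟨e1, e2⟩, e3, e4⟩ := c00 (by linarith) (by linarith) (by linarith) (by linarith)
    obtain ⟨⟨g1, g2⟩, g3, g4⟩ := c10 (by linarith) (by linarith) (by linarith) (by linarith)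
    exfalso
    rcases ht with ht | ht <;> rcases hout with hout | hout | hout | hout <;> linarith
  · obtain ⟨⟨e1, e2⟩, e3, e4⟩ := c01 (by linarith) (by linarith) (by linarith) (by linarith)
    rcases hout with hout | hout | hout | hout
    · exfalso; linarith
    · refine Or.inr (Or.inr (Or.inr (Or.inr (Or.inr (Or.inl ⟨fun q hq => ?_, hout⟩)))))
      obtain ⟨⟨q1, q2⟩, q3, q4⟩ := hmem q hq.1
      have := hq.2
      refine ⟨⟨?_, ?_⟩, ?_⟩ <;> linarith
    · refine Or.inr (Or.inr (Or.inr (Or.inr (Or.inr (Or.inr (Or.inr (Or.inr (Or.inl ⟨fun q hq => ?_, hout⟩))))))))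
      obtain ⟨⟨q1, q2⟩, q3, q4⟩ := hmem q hq.1
      have := hq.2
      refine ⟨⟨?_, ?_⟩, ?_⟩ <;> linarith
    · exfalso; linarith
  · obtain ⟨⟨e1, e2⟩, e3, e4⟩ := c00 (by linarith) (by linarith) (by linarith) (by linarith)
    obtain ⟨⟨g1, g2⟩, g3, g4⟩ := c01 (by linarith) (by linarith) (by linarith) (by linarith)
    exfalso
    rcases hr with hr | hr <;> rcases hout with hout | hout | hout | hout <;> linarith
  · obtain ⟨⟨e1, e2⟩, e3, e4⟩ := c00 (by linarith) (by linarith) (by linarith) (by linarith)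
    rcases hout with hout | hout | hout | hout
    · exfalso; linarith
    · refine Or.inr (Or.inr (Or.inr (Or.inr (Or.inr (Or.inr (Or.inr (Or.inl ⟨fun q hq => ?_, hout⟩)))))))
      obtain ⟨⟨q1, q2⟩, q3, q4⟩ := hmem q hq.1
      have := hq.2
      refine ⟨⟨?_, ?_⟩, ?_⟩ <;> linarith
    · exfalso; linarith
    · refine Or.inr (Or.inr (Or.inr (Or.inr (Or.inr (Or.inr (Or.inr (Or.inr (Or.inr (Or.inl ⟨fun q hq => ?_, hout⟩)))))))))
      obtain ⟨⟨q1, q2⟩, q3, q4⟩ := hmem q hq.1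
      have := hq.2
      refine ⟨⟨?_, ?_⟩, ?_⟩ <;> linarith

/-! ### Selection rules -/

open Classical in
/-- The number of corners of `s` in `c`. -/
noncomputable def Square.cornerCount (s : Square) (c : Set Point) : ℕ :=
  ∑ i, c.indicator (fun _ => 1) (s.corner i)

theorem Square.cornerCount_pos {s : Square} {c : Set Point} {i : Bool × Bool}
    (h : s.corner i ∈ c) : 0 < s.cornerCount c := by
  refine Finset.sum_pos' (fun _ _ => Nat.zero_le _) ⟨i, Finset.mem_univ _, ?_⟩
  simp [Set.indicator_of_mem h]

theorem Square.cornerCount_le (s : Square) (c : Set Point) : s.cornerCount c ≤ 4 := by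
  calc s.cornerCount c ≤ ∑ _i : Bool × Bool, 1 :=
        Finset.sum_le_sum fun i _ => Set.indicator_le_self' (fun _ _ => Nat.zero_le _) _
    _ = 4 := by simp

theorem sum_indicator_le_of_pairwise_disjoint {ι : Type*} [Fintype ι] {ch : ι → Set Point}
    {c : Set Point} (hsub : ∀ j, ch j ⊆ c) (hd : Pairwise fun i j => Disjoint (ch i) (ch j))
    (x : Point) :
    ∑ j, (ch j).indicator (fun _ => 1) x ≤ c.indicator (fun _ => (1 : ℕ)) x := by
  classical
  by_cases h : ∃ j, x ∈ ch j
  · obtain ⟨j, hj⟩ := h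
    rw [Finset.sum_eq_single j, Set.indicator_of_mem hj, Set.indicator_of_mem (hsub j hj)]
    · intro k _ hk
      exact Set.indicator_of_notMem (fun hx => Set.disjoint_left.1 (hd hk) hx hj) _
    · simp
  · push Not at h
    rw [Finset.sum_eq_zero fun j _ => Set.indicator_of_notMem (h j) _]
    exact Nat.zero_le _

theorem Square.sum_cornerCount_le (s : Square) {ι : Type*} [Fintype ι] {ch : ι → Set Point}
    {c : Set Point} (hsub : ∀ j, ch j ⊆ c) (hd : Pairwise fun i j => Disjoint (ch i) (ch j)) :
    ∑ j, s.cornerCount (ch j) ≤ s.cornerCount c := by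
  unfold Square.cornerCount
  rw [Finset.sum_comm]
  exact Finset.sum_le_sum fun i _ => sum_indicator_le_of_pairwise_disjoint hsub hd _

open Classical in
theorem List.length_le_sum_length_filter {ι α : Type*} [Fintype ι] (ch : ι → Set α) (l : List α)
    (h : ∀ p ∈ l, ∃ j, p ∈ ch j) :
    l.length ≤ ∑ j, (l.filter fun p => p ∈ ch j).length := by
  induction l with
  | nil => simp
  | cons a l ih =>
    obtain ⟨j, hj⟩ := h a (by simp)
    have ih' := ih fun p hp => h p (by simp [hp])
    rw [List.length_cons]
    refine Nat.succ_le_of_lt (lt_of_le_of_lt ih' (Finset.sum_lt_sum ?_ ⟨j, Finset.mem_univ _, ?_⟩))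
    · intro k _
      exact ((List.sublist_cons_self a l).filter _).length_le
    · simp [hj]

/-- There is a rule `f` assigning to each coverable point of `P` in `c` a square of `S` containing
it such that, whenever squares are bought by this rule for points not covered by squares bought
earlier, the number of squares bought is at most `12` times the size of any cover, plus `K` for each
corner in `c` of a square in the cover. -/
def HasSelectionRule (S : Finset Square) (P : Finset Point) (K : ℕ) (c : Set Point) : Prop :=
  ∃ f : Point → Square,
    (∀ p ∈ c, p ∈ P → (∃ s ∈ S, p ∈ s.region) → f p ∈ S ∧ p ∈ (f p).region) ∧
    ∀ l : List Point, (∀ p ∈ l, p ∈ c ∧ p ∈ P) → l.Pairwise (fun p q => q ∉ (f p).region) →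
      ∀ T ⊆ S, Covers T {p | p ∈ l} →
        l.length ≤ 12 * T.card + K * ∑ s ∈ T, s.cornerCount c

theorem HasSelectionRule.mono {S : Finset Square} {P : Finset Point} {K K' : ℕ} {c : Set Point}
    (h : HasSelectionRule S P K c) (hK : K ≤ K') : HasSelectionRule S P K' c := by
  obtain ⟨f, hf, hl⟩ := h
  exact ⟨f, hf, fun l h1 h2 T hT hc => (hl l h1 h2 T hT hc).trans (by gcongr)⟩

theorem Covers.length_eq_zero {T : Finset Square} {l : List Point} (h : Covers T {p | p ∈ l})
    (hT : T.card = 0) : l.length = 0 := by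
  rw [Finset.card_eq_zero] at hT
  subst hT
  rw [List.length_eq_zero_iff, List.eq_nil_iff_forall_not_mem]
  intro p hp
  obtain ⟨s, hs, _⟩ := h p hp
  simp at hs

/-- Any square containing the point will do: once it is bought, a repetition of the point is already
covered. -/
theorem hasSelectionRule_of_subsingleton (S : Finset Square) (P : Finset Point) {c : Set Point}
    (h : ∀ p ∈ c, ∀ q ∈ c, p ∈ P → q ∈ P → p = q) : HasSelectionRule S P 0 c := by
  have : ∀ p : Point, ∃ t : Square, (∃ s ∈ S, p ∈ s.region) → t ∈ S ∧ p ∈ t.region := by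
    intro p
    by_cases hp : ∃ s ∈ S, p ∈ s.region
    · obtain ⟨s, hs⟩ := hp
      exact ⟨s, fun _ => hs⟩
    · exact ⟨⟨0, 0, 1, one_pos⟩, fun h => absurd h hp⟩
  choose f hf using this
  refine ⟨f, fun p _ _ hp => hf p hp, fun l hl hpw T hT hcov => ?_⟩
  have hlen : l.length ≤ 1 := by
    match l, hl, hpw, hcov with
    | [], _, _, _ => simp
    | [a], _, _, _ => simp
    | a :: b :: l, hl, hpw, hcov =>
      have hab : b = a := h b (hl b (by simp)).1 a (hl a (by simp)).1 (hl b (by simp)).2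
        (hl a (by simp)).2
      have := List.rel_of_pairwise_cons hpw (a' := b) (by simp)
      obtain ⟨s, hs, has⟩ := hcov a (by simp)
      exact absurd (hf a ⟨s, hT hs, has⟩).2 (hab ▸ this)
  rcases Nat.eq_zero_or_pos T.card with h0 | h0
  · simp [hcov.length_eq_zero h0]
  · omega

/-- Traces are nested, so the largest extent wins. -/
theorem SquareChain.exists_max (C : SquareChain) (S : Finset Square) :
    ∃ t : Square, (∃ s ∈ S, s ∈ C.family) →
      t ∈ S ∧ ∀ s ∈ S, s ∈ C.family → ∀ p ∈ C.region, p ∈ s.region → p ∈ t.region := by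
  classical
  by_cases h : ∃ s ∈ S, s ∈ C.family
  · obtain ⟨s, hs, hsC⟩ := h
    obtain ⟨t, ht, hmax⟩ := (S.filter (· ∈ C.family)).exists_max_image C.extent
      ⟨s, by simp [hs, hsC]⟩
    rw [Finset.mem_filter] at ht
    refine ⟨t, fun _ => ⟨ht.1, fun s hs hsC p hp hps => ?_⟩⟩
    rw [C.mem_iff t ht.2 p hp]
    exact ((C.mem_iff s hsC p hp).1 hps).trans (hmax s (by simp [hs, hsC]))
  · exact ⟨⟨0, 0, 1, one_pos⟩, fun h' => absurd h' h⟩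

-- Points served by a chain cost at most 12 in total. The others are covered by the squares `T'` of
-- `T` with a corner in `c`; five parts pay at most `5 * 12 * T'.card`, and `T'.card` is at most the
-- number of corners in `c`. This is the increment 60.
open Classical in
theorem HasSelectionRule.of_partition {S : Finset Square} {P : Finset Point} {c : Set Point}
    {K : ℕ} (hc : ChainCovered c) {ι : Type*} [Fintype ι] (hι : Fintype.card ι ≤ 5)
    (ch : ι → Set Point) (hcov : ∀ p ∈ c, ∃ j, p ∈ ch j) (hsub : ∀ j, ch j ⊆ c)
    (hd : Pairwise fun i j => Disjoint (ch i) (ch j))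
    (hch : ∀ j, HasSelectionRule S P K (ch j)) : HasSelectionRule S P (K + 60) c := by
  obtain ⟨L, hL, hchain⟩ := hc
  choose g hg hgl using hch
  choose best hbest using fun C : SquareChain => C.exists_max S
  -- This refers to `S` and not to `T` or the requests, so `f` is fixed in advance.
  let A : Point → Prop := fun p =>
    ∃ C ∈ L, p ∈ C.region ∧ ∃ s ∈ S, s ∈ C.family ∧ p ∈ s.region
  have hlab : ∀ p, ∃ C : SquareChain, A p → C ∈ L ∧ best C ∈ S ∧ p ∈ (best C).region := by
    intro p
    by_cases hp : A p
    · obtain ⟨C, hC, hpC, s, hs, hsC, hps⟩ := hp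
      have := hbest C ⟨s, hs, hsC⟩
      exact ⟨C, fun _ => ⟨hC, this.1, this.2 s hs hsC p hpC hps⟩⟩
    · exact ⟨.up ∅, fun h => absurd h hp⟩
  choose lab hlab using hlab
  have hidx : ∀ p, ∃ t : Square, ∀ j, p ∈ ch j → t = g j p := by
    intro p
    by_cases h : ∃ j, p ∈ ch j
    · obtain ⟨j, hj⟩ := h
      refine ⟨g j p, fun k hk => ?_⟩
      by_contra hne
      exact Set.disjoint_left.1 (hd (fun hjk : j = k => hne (by rw [hjk]))) hj hk
    · exact ⟨⟨0, 0, 1, one_pos⟩, fun j hj => absurd ⟨j, hj⟩ h⟩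
  choose r hr using hidx
  let f : Point → Square := fun p => if A p then best (lab p) else r p
  have hfA : ∀ p, A p → f p = best (lab p) := fun p hp => if_pos hp
  have hfB : ∀ p, ¬ A p → ∀ j, p ∈ ch j → f p = g j p := fun p hp j hj =>
    (if_neg hp).trans (hr p j hj)
  refine ⟨f, ?_, ?_⟩
  · intro p hpc hpP hpS
    by_cases hA : A p
    · rw [hfA p hA]
      exact (hlab p hA).2
    · obtain ⟨j, hj⟩ := hcov p hpc
      rw [hfB p hA j hj]
      exact hg j p hj hpP hpS
  intro l hl hpw T hT hTcov
  have hlen : l.length = (l.filter A).length + (l.filter fun p => ¬ A p).length := by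
    rw [List.length_eq_length_filter_add (l := l) (fun p => decide (A p))]
    simp
  have hlenA : (l.filter A).length ≤ 12 * T.card := by
    have h12 : (l.filter A).length ≤ 12 := by
      -- Once the best square of a chain is bought, later points with the same label are covered.
      have hnd : ((l.filter A).map lab).Nodup := by
        rw [List.Nodup, List.pairwise_map]
        refine (hpw.sublist List.filter_sublist).imp_of_mem ?_
        intro p q hp hq hpq heq
        have hpA : A p := by simpa using (List.mem_filter.1 hp).2
        have hqA : A q := by simpa using (List.mem_filter.1 hq).2
        rw [hfA p hpA, heq] at hpq
        exact hpq (hlab q hqA).2.2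
      have hsubL : (l.filter A).map lab ⊆ L := by
        intro C hC
        obtain ⟨p, hp, rfl⟩ := List.mem_map.1 hC
        exact (hlab p (by simpa using (List.mem_filter.1 hp).2)).1
      have := (List.subperm_of_subset hnd hsubL).length_le
      rw [List.length_map] at this
      omega
    rcases Nat.eq_zero_or_pos T.card with h0 | h0
    · have := hTcov.length_eq_zero h0
      omega
    · omega
  set l₂ := l.filter fun p => ¬ A p with hl₂
  have hmem₂ : ∀ p ∈ l₂, p ∈ l ∧ ¬ A p := fun p hp => by
    have := List.mem_filter.1 hp
    simpa using this
  -- A square of `T` without a corner in `c` that covered a point of `l₂` would belong to a chain,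
  -- contradicting `¬ A p`.
  set T' := T.filter fun s => ∃ i, s.corner i ∈ c with hT'
  have hT'cov : ∀ p ∈ l₂, ∃ s ∈ T', p ∈ s.region := by
    intro p hp
    obtain ⟨hpl, hpA⟩ := hmem₂ p hp
    obtain ⟨s, hs, hps⟩ := hTcov p hpl
    refine ⟨s, ?_, hps⟩
    rw [hT', Finset.mem_filter]
    refine ⟨hs, ?_⟩
    by_contra! hcor
    obtain ⟨C, hC, hsC, hpC⟩ := hchain s p (hl p hpl).1 hps hcor
    exact hpA ⟨C, hC, hpC, s, hT hs, hsC, hps⟩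
  have hchild : ∀ j, (l₂.filter fun p => p ∈ ch j).length ≤
      12 * T'.card + K * ∑ s ∈ T', s.cornerCount (ch j) := by
    intro j
    have hm : ∀ p ∈ l₂.filter fun p => p ∈ ch j, p ∈ l₂ ∧ p ∈ ch j := fun p hp => by
      simpa using List.mem_filter.1 hp
    refine hgl j _ (fun p hp => ⟨(hm p hp).2, (hl p (hmem₂ p (hm p hp).1).1).2⟩) ?_ T'
      ((Finset.filter_subset _ _).trans hT) (fun p hp => hT'cov p (hm p hp).1)
    refine (hpw.sublist (List.filter_sublist.trans List.filter_sublist)).imp_of_mem ?_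
    intro p q hp _ hpq
    rwa [hfB p (hmem₂ p (hm p hp).1).2 j (hm p hp).2] at hpq
  have hcardT' : T'.card ≤ ∑ s ∈ T', s.cornerCount c := by
    rw [Finset.card_eq_sum_ones]
    refine Finset.sum_le_sum fun s hs => ?_
    obtain ⟨i, hi⟩ := (Finset.mem_filter.1 hs).2
    exact Square.cornerCount_pos hi
  have hsumT' : ∑ s ∈ T', s.cornerCount c ≤ ∑ s ∈ T, s.cornerCount c :=
    Finset.sum_le_sum_of_subset (Finset.filter_subset _ _)
  have hlenB : l₂.length ≤ 60 * T'.card + K * ∑ s ∈ T', s.cornerCount c :=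
    calc l₂.length ≤ ∑ j, (l₂.filter fun p => p ∈ ch j).length :=
          List.length_le_sum_length_filter ch l₂ fun p hp => hcov p (hl p (hmem₂ p hp).1).1
      _ ≤ ∑ j, (12 * T'.card + K * ∑ s ∈ T', s.cornerCount (ch j)) :=
          Finset.sum_le_sum fun j _ => hchild j
      _ = Fintype.card ι * (12 * T'.card) + K * ∑ s ∈ T', ∑ j, s.cornerCount (ch j) := by
          rw [Finset.sum_add_distrib, Finset.sum_const, Finset.card_univ, smul_eq_mul,
            ← Finset.mul_sum, Finset.sum_comm]
      _ ≤ 5 * (12 * T'.card) + K * ∑ s ∈ T', s.cornerCount c := by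
          gcongr with s
          exact s.sum_cornerCount_le hsub hd
      _ = _ := by ring
  have : K * ∑ s ∈ T', s.cornerCount c ≤ K * ∑ s ∈ T, s.cornerCount c :=
    Nat.mul_le_mul_left _ hsumT'
  rw [add_mul]
  omega

/-! ### Balanced subdivision -/

theorem Relation.ReflTransGen.exists_step {α : Type*} {r : α → α → Prop} {a b : α}
    (h : Relation.ReflTransGen r a b) {φ : α → Prop} (ha : φ a) (hb : ¬ φ b) :
    ∃ c d, Relation.ReflTransGen r a c ∧ r c d ∧ Relation.ReflTransGen r d b ∧ φ c ∧ ¬ φ d := by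
  induction h with
  | refl => exact absurd ha hb
  | @tail b c hab hbc ih =>
    by_cases hφ : φ b
    · exact ⟨b, c, hab, hbc, .refl, hφ, hb⟩
    · obtain ⟨x, y, h1, h2, h3, h4⟩ := ih hφ
      exact ⟨x, y, h1, h2, h3.tail hbc, h4⟩

open Classical in
/-- The number of points of `P` in `c`. -/
noncomputable def pointCount (P : Finset Point) (c : Set Point) : ℕ :=
  (P.filter (· ∈ c)).card

open Classical in
theorem pointCount_mono (P : Finset Point) {c d : Set Point} (h : c ⊆ d) :
    pointCount P c ≤ pointCount P d :=
  Finset.card_le_card (Finset.monotone_filter_right _ fun _ _ hp => h hp)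

theorem pointCount_add_le (P : Finset Point) {c d e : Set Point} (hce : c ⊆ e) (hde : d ⊆ e)
    (hcd : Disjoint c d) : pointCount P c + pointCount P d ≤ pointCount P e := by
  classical
  unfold pointCount
  rw [← Finset.card_union_of_disjoint]
  · refine Finset.card_le_card fun p hp => ?_
    simp only [Finset.mem_union, Finset.mem_filter] at hp ⊢
    rcases hp with hp | hp
    · exact ⟨hp.1, hce hp.2⟩
    · exact ⟨hp.1, hde hp.2⟩
  · rw [Finset.disjoint_left]
    intro p hp hq
    exact Set.disjoint_left.1 hcd (Finset.mem_filter.1 hp).2 (Finset.mem_filter.1 hq).2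

theorem hasSelectionRule_of_pointCount_le_one (S : Finset Square) {P : Finset Point}
    {c : Set Point} (h : pointCount P c ≤ 1) : HasSelectionRule S P 0 c := by
  classical
  refine hasSelectionRule_of_subsingleton S P fun p hp q hq hpP hqP => ?_
  exact Finset.card_le_one.1 h p (by simp [hp, hpP]) q (by simp [hq, hqP])

theorem exists_pos_forall_pointCount_le_one (P : Finset Point) :
    ∃ δ > 0, ∀ Q : Square, Q.side ≤ δ → pointCount P Q.cell ≤ 1 := by
  classical
  have hbound : ∃ δ > 0, ∀ p ∈ P, ∀ q ∈ P, p ≠ q → δ ≤ dist p q := by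
    by_cases h : (P : Set Point).Nontrivial
    · refine ⟨(P : Set Point).infsep, P.finite_toSet.infsep_pos_iff_nontrivial.2 h, ?_⟩
      intro p hp q hq hpq
      have : Finite (P : Set Point) := P.finite_toSet
      exact Set.infsep_le_dist_of_mem hp hq hpq
    · rw [Set.not_nontrivial_iff] at h
      exact ⟨1, one_pos, fun p hp q hq hpq => absurd (h hp hq) hpq⟩
  obtain ⟨δ, hδ, hmin⟩ := hbound
  refine ⟨δ, hδ, fun Q hQ => Finset.card_le_one.2 fun p hp q hq => ?_⟩
  rw [Finset.mem_filter, Square.mem_cell] at hp hq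
  obtain ⟨hpP, ⟨p1, p2⟩, p3, p4⟩ := hp
  obtain ⟨hqP, ⟨q1, q2⟩, q3, q4⟩ := hq
  by_contra hpq
  refine absurd (hmin p hpP q hqP hpq) (not_le.2 ?_)
  -- The product carries the maximum metric, and cells are half-open, so the distance is strictly
  -- below the side.
  rw [Prod.dist_eq, Real.dist_eq, Real.dist_eq, max_lt_iff, abs_lt, abs_lt]
  refine ⟨⟨?_, ?_⟩, ?_, ?_⟩ <;> linarith

/-- Descending into a heavy child as long as possible ends in a heavy cell without heavy child. -/
theorem exists_descendant_light_children (P : Finset Point) {k : ℕ} (hk : 2 ≤ k) (Q : Square)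
    (hQ : k < 2 * pointCount P Q.cell) :
    ∃ A, Q.Descendant A ∧ k < 2 * pointCount P A.cell ∧
      ∀ i, 2 * pointCount P (A.child i).cell ≤ k := by
  obtain ⟨δ, hδ, hδP⟩ := exists_pos_forall_pointCount_le_one P
  obtain ⟨n, hn⟩ := pow_unbounded_of_one_lt (Q.side / δ) one_lt_two
  have hn' : Q.side ≤ 2 ^ n * δ := ((div_lt_iff₀ hδ).1 hn).le
  clear hn
  induction n generalizing Q with
  | zero =>
    have := hδP Q (by simpa using hn')
    omega
  | succ n ih =>
    by_cases h : ∀ i, 2 * pointCount P (Q.child i).cell ≤ k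
    · exact ⟨Q, .refl, hQ, h⟩
    · push Not at h
      obtain ⟨i, hi⟩ := h
      obtain ⟨A, hA, hA'⟩ := ih (Q.child i) hi (by
        change Q.side / 2 ≤ _
        rw [pow_succ] at hn'
        linarith)
      exact ⟨A, hA.head ⟨i, rfl⟩, hA'⟩

/-- Splitting `Q \ H` into `Q \ A` and the four children of `A`, without `H`. -/
theorem HasSelectionRule.of_descendant {S : Finset Square} {P : Finset Point} {K : ℕ}
    {Q A : Square} {H : Set Point} (hc : ChainCovered (Q.cell \ H)) (hQA : Q.Descendant A)
    (hHA : H ⊆ A.cell) (hout : HasSelectionRule S P K (Q.cell \ A.cell))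
    (hin : ∀ i, HasSelectionRule S P K ((A.child i).cell \ H)) :
    HasSelectionRule S P (K + 60) (Q.cell \ H) := by
  have hchild : ∀ i, (A.child i).cell ⊆ A.cell := fun i p hp =>
    Square.mem_cell_iff_exists_child.2 ⟨i, hp⟩
  refine HasSelectionRule.of_partition hc (ι := Option (Bool × Bool)) (by simp)
    (fun j => j.elim (Q.cell \ A.cell) fun i => (A.child i).cell \ H) ?_ ?_ ?_ ?_
  · intro p hp
    by_cases hpA : p ∈ A.cell
    · obtain ⟨i, hi⟩ := Square.mem_cell_iff_exists_child.1 hpA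
      exact ⟨some i, hi, hp.2⟩
    · exact ⟨none, hp.1, hpA⟩
  · rintro (_ | i) p hp
    · exact ⟨hp.1, fun h => hp.2 (hHA h)⟩
    · exact ⟨hQA.cell_subset (hchild i hp.1), hp.2⟩
  · rintro (_ | i) (_ | j) hij
    · exact absurd rfl hij
    · exact Set.disjoint_left.2 fun p hp hq => hp.2 (hchild j hq.1)
    · exact Set.disjoint_left.2 fun p hp hq => hq.2 (hchild i hp.1)
    · exact (A.child_cell_disjoint fun h => hij (by rw [h])).mono Set.sdiff_subset Set.sdiff_subset
  · rintro (_ | i)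
    · exact hout
    · exact hin i

/-- Both bounds are proved by a joint induction. A cell with at most `2 ^ (j + 1)` points splits
into parts with at most `2 ^ j`, the costliest being a difference: `120 * j + 60 + 60`. A difference
may also produce whole cells that are not lighter, which the cell bound for `j + 1` handles at the
price of another 60. -/
theorem hasSelectionRule_of_pointCount_le (S : Finset Square) (P : Finset Point) (j : ℕ) :
    (∀ Q : Square, pointCount P Q.cell ≤ 2 ^ j → HasSelectionRule S P (120 * j) Q.cell) ∧
    ∀ Q H : Square, Q.Descendant H → pointCount P (Q.cell \ H.cell) ≤ 2 ^ j →
      HasSelectionRule S P (120 * j + 60) (Q.cell \ H.cell) := by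
  induction j with
  | zero =>
    exact ⟨fun Q h => hasSelectionRule_of_pointCount_le_one S (by simpa using h),
      fun Q H _ h => (hasSelectionRule_of_pointCount_le_one S (by simpa using h)).mono (by simp)⟩
  | succ j ih =>
    obtain ⟨ih1, ih2⟩ := ih
    have hpow : 2 ^ (j + 1) = 2 * 2 ^ j := by ring
    have h1 : ∀ Q : Square, pointCount P Q.cell ≤ 2 ^ (j + 1) →
        HasSelectionRule S P (120 * (j + 1)) Q.cell := by
      intro Q hQ
      rcases le_or_gt (pointCount P Q.cell) 1 with hk | hk
      · exact (hasSelectionRule_of_pointCount_le_one S hk).mono (Nat.zero_le _)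
      obtain ⟨A, hQA, hA, hlight⟩ := exists_descendant_light_children P
        (k := pointCount P Q.cell) (by omega) Q (by omega)
      have hadd := pointCount_add_le P (c := A.cell) (d := Q.cell \ A.cell) hQA.cell_subset
        Set.sdiff_subset Set.disjoint_sdiff_right
      have := HasSelectionRule.of_descendant (S := S) (P := P) (K := 120 * j + 60) (H := ∅)
        (by simpa using Q.chainCovered_cell) hQA (Set.empty_subset _)
        (ih2 Q A hQA (by omega)) (fun i => by
          rw [Set.sdiff_empty]
          exact (ih1 _ (by have := hlight i; omega)).mono (by omega))
      rw [Set.sdiff_empty] at this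
      exact this.mono (by omega)
    refine ⟨h1, fun Q H hQH hcount => ?_⟩
    rcases le_or_gt (pointCount P (Q.cell \ H.cell)) 1 with hk | hk
    · exact (hasSelectionRule_of_pointCount_le_one S hk).mono (Nat.zero_le _)
    -- On the path from `Q` to `H`, the part outside `H` drops from more than half of the points to
    -- none. At the step where it falls to at most half, both `Q \ A` and the child towards `H`,
    -- without `H`, are light.
    obtain ⟨A, B, hQA, ⟨i, rfl⟩, hBH, hA, hB⟩ := Relation.ReflTransGen.exists_step hQH
      (φ := fun X => pointCount P (Q.cell \ H.cell) < 2 * pointCount P (X.cell \ H.cell))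
      (by omega) (by simp [pointCount])
    have hiA : (A.child i).cell ⊆ A.cell := fun p hp =>
      Square.mem_cell_iff_exists_child.2 ⟨i, hp⟩
    have hHi : H.cell ⊆ (A.child i).cell := Square.Descendant.cell_subset hBH
    have hQA' : A.cell ⊆ Q.cell := Square.Descendant.cell_subset hQA
    have hadd := pointCount_add_le P (c := A.cell \ H.cell) (d := Q.cell \ A.cell)
      (e := Q.cell \ H.cell) (Set.sdiff_subset_sdiff_left hQA')
      (Set.sdiff_subset_sdiff_right (hHi.trans hiA))
      (Set.disjoint_sdiff_right.mono_left Set.sdiff_subset)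
    refine HasSelectionRule.of_descendant (A := A) (Square.Descendant.sticky hQH).chainCovered hQA
      (hHi.trans hiA) ((ih2 Q A hQA (by omega)).mono (by omega)) fun i' => ?_
    by_cases hi : i' = i
    · subst hi
      exact (ih2 _ H hBH (by omega)).mono (by omega)
    -- The other children may be heavy but miss `H`, so `h1` applies at the same level.
    · have hdisj : Disjoint (A.child i').cell H.cell := (A.child_cell_disjoint hi).mono_right hHi
      rw [hdisj.sdiff_eq_left]
      refine h1 _ ((pointCount_mono P ?_).trans hcount)
      intro p hp
      exact ⟨hQA' (Square.mem_cell_iff_exists_child.2 ⟨i', hp⟩),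
        fun h => Set.disjoint_left.1 hdisj hp h⟩

theorem exists_cell_superset (P : Finset Point) : ∃ Q : Square, ∀ p ∈ P, p ∈ Q.cell := by
  obtain ⟨M, hM⟩ := (P.image fun p => max |p.1| |p.2|).bddAbove
  have hM' : ∀ p ∈ P, |p.1| ≤ M ∧ |p.2| ≤ M := fun p hp =>
    max_le_iff.1 (hM (by simpa using ⟨p.1, p.2, hp, rfl⟩))
  refine ⟨⟨-(|M| + 1), -(|M| + 1), 2 * (|M| + 1), by positivity⟩, fun p hp => ?_⟩
  have h := le_abs_self M
  have := abs_le.1 (hM' p hp).1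
  have := abs_le.1 (hM' p hp).2
  rw [Square.mem_cell]
  refine ⟨⟨?_, ?_⟩, ?_, ?_⟩ <;> simp only <;> linarith

/-! ### The online algorithm -/

open Classical in
/-- The points of `l`, in order, that are not covered by the squares `f q` of earlier selected
points `q`. -/
noncomputable def selectedPoints (f : Point → Square) (l : List Point) : List Point :=
  l.foldl (fun acc p => if ∃ q ∈ acc, p ∈ (f q).region then acc else acc ++ [p]) []

open Classical in
theorem selectedPoints_append (f : Point → Square) (l : List Point) (p : Point) :
    selectedPoints f (l ++ [p]) =
      if ∃ q ∈ selectedPoints f l, p ∈ (f q).region then selectedPoints f l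
      else selectedPoints f l ++ [p] := by
  rw [selectedPoints, List.foldl_append]
  rfl

theorem selectedPoints_subset (f : Point → Square) (l : List Point) :
    selectedPoints f l ⊆ l := by
  induction l using List.reverseRecOn with
  | nil => simp [selectedPoints]
  | append_singleton l p ih =>
    rw [selectedPoints_append]
    split_ifs
    · exact fun q hq => List.mem_append_left _ (ih hq)
    · intro q hq
      rw [List.mem_append] at hq ⊢
      exact hq.imp_left fun h => ih h

theorem selectedPoints_pairwise (f : Point → Square) (l : List Point) :
    (selectedPoints f l).Pairwise fun p q => q ∉ (f p).region := by
  induction l using List.reverseRecOn with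
  | nil => simp [selectedPoints]
  | append_singleton l p ih =>
    rw [selectedPoints_append]
    split_ifs with h
    · exact ih
    · rw [List.pairwise_append]
      refine ⟨ih, by simp, fun q hq r hr => ?_⟩
      rw [List.mem_singleton] at hr
      subst hr
      exact fun hp => h ⟨q, hq, hp⟩

theorem exists_mem_selectedPoints (f : Point → Square) (l : List Point)
    (hf : ∀ p ∈ l, p ∈ (f p).region) :
    ∀ p ∈ l, ∃ q ∈ selectedPoints f l, p ∈ (f q).region := by
  induction l using List.reverseRecOn with
  | nil => simp
  | append_singleton l r ih =>
    intro p hp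
    rw [selectedPoints_append]
    rw [List.mem_append, List.mem_singleton] at hp
    have ih' := ih fun p hp => hf p (List.mem_append_left _ hp)
    split_ifs with h
    · rcases hp with hp | rfl
      · exact ih' p hp
      · exact h
    · rcases hp with hp | rfl
      · obtain ⟨q, hq, hpq⟩ := ih' p hp
        exact ⟨q, List.mem_append_left _ hq, hpq⟩
      · exact ⟨p, by simp, hf p (by simp)⟩

open Classical in
/-- The algorithm that, when an uncovered point `p` arrives, adds the square `f p`. -/
noncomputable def greedyAlgorithm (S : Finset Square) (f : Point → Square) : OnlineAlgorithm S where
  select past p :=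
    -- Testing `f p ∈ S` makes this an algorithm for arbitrary `f`.
    if f p ∈ S ∧ ¬ ∃ q ∈ selectedPoints f past, p ∈ (f q).region then {f p} else ∅
  select_subset past p := by
    split_ifs with h
    · simpa using h.1
    · simp

open Classical in
theorem OnlineAlgorithm.solution_append {S : Finset Square} (A : OnlineAlgorithm S)
    (l : List Point) (p : Point) : A.solution (l ++ [p]) = A.solution l ∪ A.select l p := by
  ext s
  simp only [OnlineAlgorithm.solution, Finset.mem_union, Finset.mem_biUnion, Finset.mem_univ,
    true_and]
  constructor
  · rintro ⟨⟨i, hi⟩, hs⟩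
    rw [List.length_append, List.length_singleton] at hi
    rcases Nat.lt_succ_iff_lt_or_eq.1 hi with h | h
    · left
      refine ⟨⟨i, h⟩, ?_⟩
      simpa [List.take_append_of_le_length h.le, List.getElem_append_left h] using hs
    · right
      subst h
      simpa using hs
  · rintro (⟨⟨i, hi⟩, hs⟩ | hs)
    · refine ⟨⟨i, by simp; omega⟩, ?_⟩
      simpa [List.take_append_of_le_length hi.le, List.getElem_append_left hi] using hs
    · exact ⟨⟨l.length, by simp⟩, by simpa using hs⟩

open Classical in
theorem greedyAlgorithm_solution (S : Finset Square) (f : Point → Square) (l : List Point)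
    (hf : ∀ p ∈ l, f p ∈ S) :
    (greedyAlgorithm S f).solution l = (selectedPoints f l).toFinset.image f := by
  induction l using List.reverseRecOn with
  | nil => simp [OnlineAlgorithm.solution, selectedPoints]
  | append_singleton l p ih =>
    rw [OnlineAlgorithm.solution_append, ih fun q hq => hf q (List.mem_append_left _ hq),
      selectedPoints_append]
    have hp : f p ∈ S := hf p (by simp)
    by_cases h : ∃ q ∈ selectedPoints f l, p ∈ (f q).region
    · rw [if_pos h]
      simp only [greedyAlgorithm]
      rw [if_neg fun h' => h'.2 h, Finset.union_empty]
    · rw [if_neg h]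
      simp only [greedyAlgorithm]
      rw [if_pos ⟨hp, h⟩, List.toFinset_append, Finset.image_union]
      simp

theorem exists_card_eq_optCover {S : Finset Square} {U : Set Point} (h : Covers S U) :
    ∃ T ⊆ S, Covers T U ∧ T.card = optCover S U :=
  Nat.sInf_mem (s := {k : ℕ | ∃ T : Finset Square, T ⊆ S ∧ Covers T U ∧ T.card = k})
    ⟨S.card, S, Finset.Subset.refl S, h, rfl⟩

theorem exists_isCompetitive_clog (S : Finset Square) (P : Finset Point) :
    ∃ A : OnlineAlgorithm S,
      A.IsCompetitive (P : Set Point) ((12 + 480 * Nat.clog 2 P.card : ℕ) : ℝ) := by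
  classical
  obtain ⟨Q, hQ⟩ := exists_cell_superset P
  obtain ⟨f, hf, hbound⟩ := (hasSelectionRule_of_pointCount_le S P (Nat.clog 2 P.card)).1 Q
    ((Finset.card_filter_le _ _).trans (Nat.le_pow_clog one_lt_two _))
  refine ⟨greedyAlgorithm S f, fun l hl hcov => ?_⟩
  have hfl : ∀ p ∈ l, f p ∈ S ∧ p ∈ (f p).region := fun p hp =>
    hf p (hQ p (hl p hp)) (hl p hp) (hcov p hp)
  rw [greedyAlgorithm_solution S f l fun p hp => (hfl p hp).1]
  constructor
  · intro p hp
    obtain ⟨q, hq, hpq⟩ := exists_mem_selectedPoints f l (fun p hp => (hfl p hp).2) p hp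
    exact ⟨f q, Finset.mem_image_of_mem f (by simpa using hq), hpq⟩
  · obtain ⟨T, hTS, hT, hcard⟩ := exists_card_eq_optCover hcov
    have hsub := selectedPoints_subset f l
    have h := hbound (selectedPoints f l)
      (fun p hp => ⟨hQ p (hl p (hsub hp)), hl p (hsub hp)⟩) (selectedPoints_pairwise f l) T hTS
      (fun p hp => hT p (hsub hp))
    have h4 : ∑ s ∈ T, s.cornerCount Q.cell ≤ T.card * 4 :=
      Finset.sum_le_card_nsmul _ _ _ fun s _ => s.cornerCount_le _
    rw [← hcard]
    norm_cast
    calc ((selectedPoints f l).toFinset.image f).card ≤ (selectedPoints f l).length :=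
          Finset.card_image_le.trans (List.toFinset_card_le _)
      _ ≤ 12 * T.card + 120 * Nat.clog 2 P.card * (T.card * 4) := h.trans (by gcongr)
      _ = _ := by ring

/-! ### Logarithmic ratios and integral points -/

theorem OnlineAlgorithm.IsCompetitive.mono {S : Finset Square} {A : OnlineAlgorithm S}
    {U : Set Point} {r r' : ℝ} (h : A.IsCompetitive U r) (hr : r ≤ r') : A.IsCompetitive U r' :=
  fun l hl hc => ⟨(h l hl hc).1, (h l hl hc).2.trans (by gcongr)⟩

theorem OnlineAlgorithm.isCompetitive_empty {S : Finset Square} (A : OnlineAlgorithm S) {r : ℝ}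
    (hr : 0 ≤ r) : A.IsCompetitive ∅ r := by
  intro l hl _
  obtain rfl : l = [] := List.eq_nil_iff_forall_not_mem.2 hl
  refine ⟨fun p hp => by simp at hp, ?_⟩
  simpa [OnlineAlgorithm.solution] using mul_nonneg hr (Nat.cast_nonneg _)

/-- Since `2 ^ Nat.clog 2 n ≤ 2 * n`, the logarithm of this power is at most `2 * Real.log (n + 1)`;
hence `972 = 12 + 2 * 480`. -/
theorem clog_bound {n : ℕ} (hn : 1 ≤ n) :
    ((12 + 480 * Nat.clog 2 n : ℕ) : ℝ) ≤ 972 / Real.log 2 * Real.log ((n : ℝ) + 1) := by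
  have h2 : 0 < Real.log 2 := Real.log_pos one_lt_two
  have hn1 : (1 : ℝ) ≤ n := by exact_mod_cast hn
  have hlog : Real.log 2 ≤ Real.log ((n : ℝ) + 1) := Real.log_le_log two_pos (by linarith)
  have hclog : (Nat.clog 2 n : ℝ) * Real.log 2 ≤ 2 * Real.log ((n : ℝ) + 1) := by
    have hpow : 2 ^ Nat.clog 2 n ≤ 2 * n := by
      rcases hn.eq_or_lt with rfl | hn
      · simp
      · have hpos : 0 < Nat.clog 2 n := Nat.clog_pos one_lt_two hn
        have := Nat.pow_pred_clog_lt_self one_lt_two hn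
        calc 2 ^ Nat.clog 2 n = 2 * 2 ^ (Nat.clog 2 n).pred := by
              rw [← pow_succ', ← Nat.succ_eq_add_one, Nat.succ_pred_eq_of_pos hpos]
          _ ≤ 2 * n := by omega
    have hpow' : (2 : ℝ) ^ Nat.clog 2 n ≤ 2 * n := by exact_mod_cast hpow
    have := Real.log_le_log (by positivity) hpow'
    rw [Real.log_pow, Real.log_mul two_ne_zero (by positivity)] at this
    have : Real.log n ≤ Real.log ((n : ℝ) + 1) := Real.log_le_log (by linarith) (by linarith)
    linarith
  rw [div_mul_eq_mul_div, le_div_iff₀ h2]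
  push_cast
  nlinarith

theorem exists_isCompetitive (S : Finset Square) (P : Finset Point) :
    ∃ A : OnlineAlgorithm S, A.IsCompetitive (P : Set Point)
      (972 / Real.log 2 * Real.log ((P.card : ℝ) + 1)) := by
  obtain ⟨A, hA⟩ := exists_isCompetitive_clog S P
  refine ⟨A, ?_⟩
  rcases P.eq_empty_or_nonempty with rfl | hP
  -- Here the ratio is `Real.log 1 = 0`, but no point can arrive.
  · simpa using A.isCompetitive_empty le_rfl
  · exact hA.mono (clog_bound hP.card_pos)

open Classical in
/-- The points with integral coordinates in `[0, N)²` as a finite set. -/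
noncomputable def gridFinset (N : ℕ) : Finset Point :=
  (Finset.range N ×ˢ Finset.range N).image fun a => ((a.1 : ℝ), (a.2 : ℝ))

theorem coe_gridFinset (N : ℕ) : (gridFinset N : Set Point) = gridPoints N := by
  ext p
  simp only [gridFinset, gridPoints, Finset.coe_image, Set.mem_image, Finset.mem_coe,
    Finset.mem_product, Finset.mem_range, Prod.exists, Set.mem_ofPred_eq]
  exact ⟨fun ⟨a, b, h, e⟩ => ⟨a, b, h.1, h.2, e.symm⟩, fun ⟨a, b, h, h', e⟩ =>
    ⟨a, b, ⟨h, h'⟩, e.symm⟩⟩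

theorem card_gridFinset_le (N : ℕ) : (gridFinset N).card ≤ N ^ 2 :=
  Finset.card_image_le.trans (by simp [sq])

theorem mainTheorem1 :
    (∃ C : ℝ, ∃ A : (S : Finset Square) → Finset Point → OnlineAlgorithm S,
      ∀ (S : Finset Square) (P₀ : Finset Point),
        (A S P₀).IsCompetitive (P₀ : Set Point) (C * Real.log ((P₀.card : ℝ) + 1))) ∧
    (∃ C : ℝ, ∃ A : (S : Finset Square) → ℕ → OnlineAlgorithm S,
      ∀ (S : Finset Square) (N : ℕ), (∀ s ∈ S, s.OnGrid N) →
        (A S N).IsCompetitive (gridPoints N) (C * Real.log ((N : ℝ) + 1))) := by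
  choose A hA using exists_isCompetitive
  -- The factor 2 comes from `N ^ 2 + 1 ≤ (N + 1) ^ 2`.
  refine ⟨⟨_, A, hA⟩, 972 / Real.log 2 * 2, fun S N => A S (gridFinset N), fun S N _ => ?_⟩
  have h := hA S (gridFinset N)
  rw [coe_gridFinset] at h
  refine h.mono ?_
  have h2 : 0 < Real.log 2 := Real.log_pos one_lt_two
  have hcard : ((gridFinset N).card : ℝ) ≤ (N : ℝ) ^ 2 := by
    exact_mod_cast card_gridFinset_le N
  have hN : (0 : ℝ) ≤ N := Nat.cast_nonneg N
  have hlog : Real.log ((gridFinset N).card + 1) ≤ 2 * Real.log ((N : ℝ) + 1) := by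
    calc Real.log ((gridFinset N).card + 1) ≤ Real.log (((N : ℝ) + 1) ^ 2) :=
          Real.log_le_log (by positivity) (by nlinarith)
      _ = 2 * Real.log ((N : ℝ) + 1) := by rw [Real.log_pow]; norm_num
  rw [mul_assoc]
  exact mul_le_mul_of_nonneg_left hlog (by positivity)
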